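/- There are absolute constants $C, c, C', c'$ such that the following holds. Let $d, k \ge 0$ be integers, let $\Delta, \varepsilon > 0$ be real numbers, and put $D = d\Delta/\varepsilon$, $f = kD + k^{2/3}D^4$ and $g = kD^4$. Equip $[0,\Delta]^d$ with the $\ell_1$ metric, and for Borel probability distributions $p, q$ on it let $$\mathrm{EMD}(p,q) = \inf_{\gamma} \int \|x-y\|_1 \, d\gamma(x,y),$$ the infimum being over all couplings $\gamma$ of $p$ and $q$ (for finitely supported $p, q$ this is the minimum cost of a flow with supply $p$ and demand $q$). Then there is a randomized tester, depending only on $d, \Delta, \varepsilon, k$, that draws a fixed number $N$ of independent samples in total, half of them from $p$ and half from $q$, and then accepts or rejects, such that for all Borel probability distributions $p, q$ on $[0,\Delta]^d$ whose combined support $\mathrm{supp}(p) \cup \mathrm{supp}(q)$ can be partitioned into $k$ (possibly empty) clusters of diameter at most $\varepsilon/4$ (the clusters and their centers are not given to the tester): 1. if $p = q$, it accepts with probability at least $2/3$; 2. if $\mathrm{EMD}(p,q) > \varepsilon$, it rejects with probability at least $2/3$. Its number of samples satisfies $$N \le C f \log^{c}(2+f) \quad\text{and}\quad N \le C' g \log^{c'}(2+g),$$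 that is, $N = \tilde O\left(kd\Delta/\varepsilon + k^{2/3}(d\Delta/\varepsilon)^4\right)$ and $N = \tilde O\left(k(d\Delta/\varepsilon)^4\right)$. Moreover, whenever $\varepsilon \le d\Delta$, the first bound is at most the second: $C f \log^{c}(2+f) \le C' g \log^{c'}(2+g)$. -/

import Mathlib

open MeasureTheory ProbabilityTheory
open scoped ENNReal

noncomputable section

namespace EMDTesting

/-- `ℝ^d` with the `ℓ₁` metric. -/
abbrev L1Space (d : ℕ) : Type := PiLp 1 (fun _ : Fin d => ℝ)

/-- The cube `[0, Δ]^d`. -/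
def cube (d : ℕ) (Δ : ℝ) : Set (L1Space d) :=
  {x | ∀ i, 0 ≤ x i ∧ x i ≤ Δ}

/-- The Earth Mover's Distance: the infimum of the transport cost over all couplings of `p`
and `q`. For finitely supported `p`, `q` a coupling is a satisfying flow of the supply-demand
network, and the integral is the cost of the flow. -/
def EMD {X : Type*} [PseudoEMetricSpace X] [MeasurableSpace X] (p q : Measure X) : ℝ≥0∞ :=
  ⨅ γ : {γ : Measure (X × X) // γ.fst = p ∧ γ.snd = q}, ∫⁻ z, edist z.1 z.2 ∂γ.1

/-- The set `S` can be partitioned into `k` (possibly empty) clusters of diameter at most `b`. -/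
def Clusterable {X : Type*} [PseudoMetricSpace X] (S : Set X) (k : ℕ) (b : ℝ) : Prop :=
  ∃ C : Fin k → Set X, (⋃ i, C i) = S ∧ Pairwise (Function.onFun Disjoint C) ∧
    ∀ i, ∀ x ∈ C i, ∀ y ∈ C i, dist x y ≤ b

/-- A randomized algorithm that reads `n` samples from each of two distributions and then
answers `true` (accept) or `false` (reject): a Markov kernel from the samples to `Bool`. -/
structure SampleTester (X : Type*) [MeasurableSpace X] where
  /-- number of samples drawn from each of the two distributions -/
  n : ℕ
  /-- the law of the answer, given the samples -/
  rule : Kernel ((Fin n → X) × (Fin n → X)) Bool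
  /-- the answer is always given -/
  markov : IsMarkovKernel rule

/-- Total number of samples that the tester draws. -/
def SampleTester.samples {X : Type*} [MeasurableSpace X] (T : SampleTester X) : ℕ :=
  2 * T.n

/-- The law of the answer when all samples are independent, those of the first kind with law `p`
and those of the second kind with law `q`. -/
def SampleTester.answerLaw {X : Type*} [MeasurableSpace X] (T : SampleTester X)
    (p q : Measure X) : Measure Bool :=
  ((Measure.pi fun _ : Fin T.n => p).prod (Measure.pi fun _ : Fin T.n => q)).bind T.rule

/-- `T` is an EMD-closeness tester with parameter `ε` for the pairs of distributions in `A`. -/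
def SampleTester.IsEMDClosenessTester {X : Type*} [PseudoEMetricSpace X] [MeasurableSpace X]
    (T : SampleTester X) (ε : ℝ) (A : Set (Measure X × Measure X)) : Prop :=
  ∀ p q : Measure X, (p, q) ∈ A →
    (p = q → 2 / 3 ≤ T.answerLaw p q {true}) ∧
    (ENNReal.ofReal ε < EMD p q → 2 / 3 ≤ T.answerLaw p q {false})

/-- Pairs of Borel probability distributions on `[0, Δ]^d` whose combined support can be
partitioned into `k` clusters of diameter at most `b`. -/
def clusterablePairs (d : ℕ) (Δ : ℝ) (k : ℕ) (b : ℝ) :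
    Set (Measure (L1Space d) × Measure (L1Space d)) :=
  {pq | IsProbabilityMeasure pq.1 ∧ IsProbabilityMeasure pq.2 ∧
    pq.1 (cube d Δ)ᶜ = 0 ∧ pq.2 (cube d Δ)ᶜ = 0 ∧
    Clusterable (pq.1.support ∪ pq.2.support) k b}

/-- The bound `C · f · log^c (2 + f)`; a quantity is `Õ(f)` if it is at most this for some
constants `C` and `c`. -/
def softBound (C : ℝ) (c : ℕ) (f : ℝ) : ℝ :=
  C * f * Real.log (2 + f) ^ c

end EMDTesting

end

/-! Put `D = dΔ/ε`. The sample itself supplies a cover: take balls of radius `ε/4` about `n` draws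
from `p`, make them disjoint by choosing the first ball that contains a point, and add one cell for
uncovered points. A cluster of mass `r` is missed with probability `(1 - r)^n`, so the expected
uncovered mass of `p` is at most `k/n`, and `n ≥ 36kD` makes it at most `1/(4D)` outside probability
`1/9` (`measureReal_uncovered_le`).

Couple `p` and `q` by matching as much mass as possible within each cell. Matching in a covered cell
costs at most `ε/2` per unit; all other transport costs at most `Dε` per unit. Hence `EMD > ε`
forces the cell distributions to be at `ℓ₁` distance at least `1/(2D)` (`EMD_le_of_partition`,
`le_sum_abs_of_lt_EMD`).

What remains is `ℓ₁` closeness testing on `n + 1` cells with fresh samples. One block of pairs sets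
flattening weights `wᵢ = 1/(1 + hits)`; two further blocks give `Σ wᵢ Xᵢ X'ᵢ`, with `X`, `X'` the
count differences. Its mean is `n²S` for `S = Σ wᵢ(pᵢ - qᵢ)²`, which vanishes if `p = q` and is at
least `n/(16D²)` by Cauchy–Schwarz if the cell distributions are far. Flattening keeps the noise of
order `√n` when `p = q` and small relative to the mean otherwise, so `n ≥ 10¹²D⁴` suffices
(`measureReal_rejectSet_le`, `measureReal_rejectSet_compl_le`).

The total is `O(kD + D⁴)`, within both bounds and without logarithms. -/

noncomputable section

namespace EMDTesting

/-! ### Moments of i.i.d. sums and conditioning on a block -/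

section IIDSums

variable {Z : Type*} [Finite Z] [MeasurableSpace Z] [MeasurableSingletonClass Z]

/-- The second moment of an i.i.d. sum about a point `c`. -/
lemma integral_iid_sum_sub_sq_le (μ : Measure Z) [IsProbabilityMeasure μ] (n : ℕ) (h : Z → ℝ)
    (c : ℝ) :
    ∫ ω, (∑ s, h (ω s) - c) ^ 2 ∂(Measure.pi fun _ : Fin n => μ) ≤
      n * ∫ z, h z ^ 2 ∂μ + (n * ∫ z, h z ∂μ - c) ^ 2 := by
  have hvar := variance_sum_pi (μ := fun _ : Fin n => μ) (X := fun _ => h)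
    (fun _ => MemLp.of_discrete)
  have hmean : ∫ ω, ∑ s, h (ω s) ∂(Measure.pi fun _ : Fin n => μ) = n * ∫ z, h z ∂μ := by
    rw [integral_finsetSum _ fun _ _ => Integrable.of_finite]
    have (s : Fin n) : ∫ ω, h (ω s) ∂(Measure.pi fun _ : Fin n => μ) = ∫ z, h z ∂μ :=
      integral_comp_eval (μ := fun _ : Fin n => μ) (Measurable.of_discrete).aestronglyMeasurable
    simp [this]
  have hfun : (∑ s : Fin n, fun ω : Fin n → Z => h (ω s)) = fun ω => ∑ s, h (ω s) := by
    ext ω; simp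
  rw [hfun, variance_eq_sub MemLp.of_discrete] at hvar
  simp only [Pi.pow_apply, hmean, Finset.sum_const, Finset.card_univ, Fintype.card_fin,
    nsmul_eq_mul] at hvar
  have hle : Var[h; μ] ≤ ∫ z, h z ^ 2 ∂μ :=
    variance_le_expectation_sq (Measurable.of_discrete).aestronglyMeasurable
  have hn : (n : ℝ) * Var[h; μ] ≤ n * ∫ z, h z ^ 2 ∂μ := by gcongr
  have hexp : ∫ ω, (∑ s, h (ω s) - c) ^ 2 ∂(Measure.pi fun _ : Fin n => μ) =
      ∫ ω, (∑ s, h (ω s)) ^ 2 ∂(Measure.pi fun _ : Fin n => μ)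
        - 2 * c * (n * ∫ z, h z ∂μ) + c ^ 2 := by
    rw [← hmean, ← integral_const_mul, ← integral_sub Integrable.of_finite Integrable.of_finite]
    have : c ^ 2 = ∫ _ω, c ^ 2 ∂(Measure.pi fun _ : Fin n => μ) := by simp
    rw [this, ← integral_add Integrable.of_finite Integrable.of_finite]
    congr 1; ext ω; ring
  rw [hexp]
  nlinarith

end IIDSums

/-- If `G` has probability at least `1 - a` and `S` has conditional probability at most `b`
given any point of `G`, then `S` has probability at most `a + b`. -/
lemma measureReal_prod_le_add {α β : Type*} [MeasurableSpace α] [MeasurableSpace β]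
    (μ : Measure α) (ν : Measure β) [IsProbabilityMeasure μ] [IsProbabilityMeasure ν]
    {S : Set (α × β)} (hS : MeasurableSet S) {G : Set α} {a b : ℝ} (hb0 : 0 ≤ b)
    (ha : μ.real Gᶜ ≤ a) (hb : ∀ x ∈ G, ν.real (Prod.mk x ⁻¹' S) ≤ b) :
    (μ.prod ν).real S ≤ a + b := by
  have ha0 : 0 ≤ a := measureReal_nonneg.trans ha
  rw [Measure.real]
  refine ENNReal.toReal_le_of_le_ofReal (by positivity) ?_
  -- `G` need not be measurable, so the split is made along a measurable hull of its complement.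
  set H := toMeasurable μ Gᶜ with hH
  have hHm : MeasurableSet H := measurableSet_toMeasurable _ _
  rw [Measure.prod_apply hS, ← lintegral_add_compl _ hHm, ENNReal.ofReal_add ha0 hb0]
  refine add_le_add ?_ ?_
  · calc ∫⁻ x in H, ν (Prod.mk x ⁻¹' S) ∂μ ≤ ∫⁻ _ in H, 1 ∂μ :=
          lintegral_mono fun x => prob_le_one
      _ = μ Gᶜ := by simp [hH]
      _ ≤ ENNReal.ofReal a := (ENNReal.le_ofReal_iff_toReal_le (measure_ne_top _ _) ha0).2 ha
  · calc ∫⁻ x in Hᶜ, ν (Prod.mk x ⁻¹' S) ∂μ ≤ ∫⁻ _ in Hᶜ, ENNReal.ofReal b ∂μ := by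
          refine setLIntegral_mono' hHm.compl fun x hx => ?_
          have hxG : x ∈ G := by
            by_contra h
            exact hx (subset_toMeasurable _ _ h)
          exact (ENNReal.le_ofReal_iff_toReal_le (measure_ne_top _ _) hb0).2 (hb x hxG)
      _ ≤ ENNReal.ofReal b := by
          simp only [lintegral_const, Measure.restrict_apply MeasurableSet.univ, Set.univ_inter]
          exact mul_le_of_le_one_right' prob_le_one

section PairIntegrals

variable {ι : Type*} [Fintype ι] [MeasurableSpace ι] [MeasurableSingletonClass ι]
variable (p q : Measure ι) [IsProbabilityMeasure p] [IsProbabilityMeasure q]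

lemma integral_prod_sub (c : ι → ℝ) :
    ∫ z, (c z.1 - c z.2) ∂(p.prod q) = ∑ i, c i * (p.real {i} - q.real {i}) := by
  rw [integral_sub Integrable.of_finite Integrable.of_finite, integral_fun_fst c,
    integral_fun_snd c, integral_fintype Integrable.of_finite,
    integral_fintype Integrable.of_finite]
  simp [← Finset.sum_sub_distrib]
  exact Finset.sum_congr rfl fun i _ => by ring

lemma integral_prod_sub_sq_le (c : ι → ℝ) :
    ∫ z, (c z.1 - c z.2) ^ 2 ∂(p.prod q) ≤ 2 * ∑ i, c i ^ 2 * (p.real {i} + q.real {i}) := by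
  calc ∫ z, (c z.1 - c z.2) ^ 2 ∂(p.prod q)
      ≤ ∫ z, 2 * (c z.1 ^ 2 + c z.2 ^ 2) ∂(p.prod q) := by
        refine integral_mono Integrable.of_finite Integrable.of_finite fun z => ?_
        dsimp only
        nlinarith [sq_nonneg (c z.1 + c z.2)]
    _ = _ := by
        rw [integral_const_mul, integral_add Integrable.of_finite Integrable.of_finite,
          integral_fun_fst (fun i => c i ^ 2), integral_fun_snd (fun i => c i ^ 2),
          integral_fintype Integrable.of_finite, integral_fintype Integrable.of_finite]
        simp [← Finset.sum_add_distrib]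
        exact Finset.sum_congr rfl fun i _ => by ring

lemma sum_real_singleton : ∑ i, (p.real {i} + q.real {i}) = 2 := by
  rw [Finset.sum_add_distrib, sum_measureReal_singleton, sum_measureReal_singleton]
  simp; norm_num

end PairIntegrals

/-! ### Closeness testing in `ℓ₁` on a finite domain by flattening -/

section FiniteDomain

variable {ι : Type*} [DecidableEq ι]

/-- The number of first components equal to `i` minus the number of second components equal
to `i`. -/
def countDiff {n : ℕ} (ω : Fin n → ι × ι) (i : ι) : ℝ :=
  ∑ s, ((if (ω s).1 = i then 1 else 0) - (if (ω s).2 = i then 1 else 0))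

/-- The number of pairs in which `i` occurs. -/
def hitCount {n : ℕ} (ω : Fin n → ι × ι) (i : ι) : ℝ :=
  ∑ s, if (ω s).1 = i ∨ (ω s).2 = i then 1 else 0

/-- The flattening weight of `i` determined by the sample `ω`. -/
def weight {n : ℕ} (ω : Fin n → ι × ι) (i : ι) : ℝ := (1 + hitCount ω i)⁻¹

lemma hitCount_nonneg {n : ℕ} (ω : Fin n → ι × ι) (i : ι) : 0 ≤ hitCount ω i :=
  Finset.sum_nonneg fun s _ => by split_ifs <;> norm_num

lemma weight_pos {n : ℕ} (ω : Fin n → ι × ι) (i : ι) : 0 < weight ω i :=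
  inv_pos.2 (by linarith [hitCount_nonneg ω i])

lemma weight_le_one {n : ℕ} (ω : Fin n → ι × ι) (i : ι) : weight ω i ≤ 1 :=
  inv_le_one_of_one_le₀ (by linarith [hitCount_nonneg ω i])

variable [Fintype ι]

/-- The weighted inner product of the count differences of two samples. -/
def stat {n : ℕ} (w : ι → ℝ) (ω ω' : Fin n → ι × ι) : ℝ :=
  ∑ i, w i * countDiff ω i * countDiff ω' i

lemma sum_mul_countDiff {n : ℕ} (c : ι → ℝ) (ω : Fin n → ι × ι) :
    ∑ i, c i * countDiff ω i = ∑ s, (c (ω s).1 - c (ω s).2) := by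
  simp only [countDiff, Finset.mul_sum]
  rw [Finset.sum_comm]
  refine Finset.sum_congr rfl fun s _ => ?_
  simp [mul_sub, Finset.sum_sub_distrib]

lemma sum_hitCount_le {n : ℕ} (ω : Fin n → ι × ι) : ∑ i, hitCount ω i ≤ 2 * n := by
  simp only [hitCount]
  rw [Finset.sum_comm]
  calc ∑ s, ∑ i, (if (ω s).1 = i ∨ (ω s).2 = i then (1 : ℝ) else 0)
      ≤ ∑ s : Fin n, ∑ i, ((if (ω s).1 = i then (1 : ℝ) else 0) +
          if (ω s).2 = i then 1 else 0) := by
        gcongr with s _ i _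
        split_ifs <;> simp_all
    _ = 2 * n := by simp [Finset.sum_add_distrib]; ring

/-- Cauchy–Schwarz for the flattening weights. -/
lemma sq_sum_abs_le {n : ℕ} (ω : Fin n → ι × ι) (v : ι → ℝ) :
    (∑ i, |v i|) ^ 2 ≤ (∑ i, weight ω i * v i ^ 2) * (Fintype.card ι + 2 * n) := by
  have h := Finset.sum_sq_le_sum_mul_sum_of_sq_le_mul Finset.univ (r := fun i => |v i|)
    (f := fun i => weight ω i * v i ^ 2) (g := fun i => 1 + hitCount ω i)
    (fun i _ => by have := weight_pos ω i; positivity)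
    (fun i _ => by have := hitCount_nonneg ω i; positivity)
    (fun i _ => by
      have : 1 + hitCount ω i ≠ 0 := by linarith [hitCount_nonneg ω i]
      rw [sq_abs, weight]; field_simp; rfl)
  refine h.trans ?_
  gcongr
  · exact Finset.sum_nonneg fun i _ => by have := weight_pos ω i; positivity
  · rw [Finset.sum_add_distrib]
    simpa using sum_hitCount_le ω

variable [MeasurableSpace ι] [MeasurableSingletonClass ι]
variable (p q : Measure ι) [IsProbabilityMeasure p] [IsProbabilityMeasure q]

lemma integral_countDiff_sq_le (n : ℕ) (i : ι) :
    ∫ ω, countDiff ω i ^ 2 ∂(Measure.pi fun _ : Fin n => p.prod q) ≤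
      n * (p.real {i} + q.real {i}) + (n * (p.real {i} - q.real {i})) ^ 2 := by
  have h := integral_iid_sum_sub_sq_le (p.prod q) n
    (fun z => (if z.1 = i then 1 else 0) - (if z.2 = i then 1 else 0)) 0
  rw [integral_prod_sub p q (fun j => if j = i then 1 else 0)] at h
  simp only [sub_zero, ite_mul, one_mul, zero_mul, Finset.sum_ite_eq', Finset.mem_univ,
    if_true] at h
  refine h.trans ?_
  gcongr
  calc ∫ z : ι × ι, ((if z.1 = i then (1 : ℝ) else 0) - (if z.2 = i then 1 else 0)) ^ 2 ∂(p.prod q)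
      ≤ ∫ z : ι × ι, ((if z.1 = i then (1 : ℝ) else 0) + (if z.2 = i then 1 else 0))
          ∂(p.prod q) := by
        refine integral_mono Integrable.of_finite Integrable.of_finite fun z => ?_
        dsimp only
        split_ifs <;> norm_num
    _ = _ := by
        rw [integral_add Integrable.of_finite Integrable.of_finite,
          integral_fun_fst (fun j => if j = i then (1 : ℝ) else 0),
          integral_fun_snd (fun j => if j = i then (1 : ℝ) else 0),
          integral_fintype Integrable.of_finite, integral_fintype Integrable.of_finite]
        simp

/-- With the first sample fixed, the statistic is an i.i.d. sum over the second, so its second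
moment splits into a variance and a squared bias (`inner`). The bias is again a centred i.i.d. sum
over the first sample (`outer`), and the variance is averaged through the second moments of the
counts (`mid`). -/
lemma integral_stat_sub_sq_le (n : ℕ) (w : ι → ℝ) (hw : ∀ i, 0 ≤ w i) (b : ℝ)
    (hb : ∀ i, w i * (p.real {i} + q.real {i}) ≤ b) (S : ℝ)
    (hS : S = ∑ i, w i * (p.real {i} - q.real {i}) ^ 2) :
    ∫ ω, (stat w ω.1 ω.2 - n ^ 2 * S) ^ 2 ∂((Measure.pi fun _ : Fin n => p.prod q).prod
        (Measure.pi fun _ : Fin n => p.prod q)) ≤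
      2 * n ^ 2 * ∑ i, (w i * (p.real {i} + q.real {i})) ^ 2 + 4 * n ^ 3 * (b * S) := by
  set ν := Measure.pi fun _ : Fin n => p.prod q
  set r : ι → ℝ := fun i => p.real {i} + q.real {i} with hr
  set m : ι → ℝ := fun i => p.real {i} - q.real {i} with hm
  have hr0 (i) : 0 ≤ r i := by positivity
  have hbS : ∑ i, (w i * m i) ^ 2 * r i ≤ b * S := by
    rw [hS, Finset.mul_sum]
    -- Regroup `w²m²r` as `(wr)(wm²)` and bound the first factor by `b`.
    refine Finset.sum_le_sum fun i _ => ?_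
    nlinarith [mul_le_mul_of_nonneg_right (hb i) (mul_nonneg (hw i) (sq_nonneg (m i)))]
  have inner (ω : Fin n → ι × ι) : ∫ ω', (stat w ω ω' - n ^ 2 * S) ^ 2 ∂ν ≤
      n * (2 * ∑ i, (w i * countDiff ω i) ^ 2 * r i) +
        n ^ 2 * (∑ s, (w (ω s).1 * m (ω s).1 - w (ω s).2 * m (ω s).2) - n * S) ^ 2 := by
    simp only [stat, sum_mul_countDiff (fun i => w i * countDiff ω i)]
    refine (integral_iid_sum_sub_sq_le (p.prod q) n
      (fun z => w z.1 * countDiff ω z.1 - w z.2 * countDiff ω z.2) _).trans ?_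
    rw [integral_prod_sub p q (fun i => w i * countDiff ω i),
      ← sum_mul_countDiff (fun i => w i * m i)]
    refine add_le_add ?_ (le_of_eq ?_)
    · gcongr
      exact integral_prod_sub_sq_le p q (fun i => w i * countDiff ω i)
    · have : ∑ i, w i * countDiff ω i * (p.real {i} - q.real {i}) =
          ∑ i, w i * m i * countDiff ω i := Finset.sum_congr rfl fun i _ => by simp only [hm]; ring
      rw [this]; ring
  have outer : ∫ ω, (∑ s, (w (ω s).1 * m (ω s).1 - w (ω s).2 * m (ω s).2) - n * S) ^ 2 ∂ν ≤
      n * (2 * (b * S)) := by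
    refine (integral_iid_sum_sub_sq_le (p.prod q) n
      (fun z => w z.1 * m z.1 - w z.2 * m z.2) _).trans ?_
    rw [integral_prod_sub p q (fun i => w i * m i)]
    have : ∑ i, w i * m i * (p.real {i} - q.real {i}) = S := by
      rw [hS]; exact Finset.sum_congr rfl fun i _ => by simp only [hm]; ring
    rw [this, sub_self]
    have := integral_prod_sub_sq_le p q (fun i => w i * m i)
    simp only [ne_eq, OfNat.ofNat_ne_zero, not_false_eq_true, zero_pow, add_zero]
    gcongr
    linarith
  have mid : ∫ ω, ∑ i, (w i * countDiff ω i) ^ 2 * r i ∂ν ≤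
      n * ∑ i, (w i * r i) ^ 2 + n ^ 2 * (b * S) := by
    rw [integral_finsetSum _ fun _ _ => Integrable.of_finite]
    calc ∑ i, ∫ ω, (w i * countDiff ω i) ^ 2 * r i ∂ν
        = ∑ i, w i ^ 2 * r i * ∫ ω, countDiff ω i ^ 2 ∂ν := by
          refine Finset.sum_congr rfl fun i _ => ?_
          rw [← integral_const_mul]
          congr 1; ext ω; ring
      _ ≤ ∑ i, w i ^ 2 * r i * (n * r i + (n * m i) ^ 2) := by
          refine Finset.sum_le_sum fun i _ => mul_le_mul_of_nonneg_left
            (integral_countDiff_sq_le p q n i) (mul_nonneg (sq_nonneg _) (hr0 i))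
      _ = n * ∑ i, (w i * r i) ^ 2 + n ^ 2 * ∑ i, (w i * m i) ^ 2 * r i := by
          rw [Finset.mul_sum, Finset.mul_sum, ← Finset.sum_add_distrib]
          exact Finset.sum_congr rfl fun i _ => by ring
      _ ≤ _ := by gcongr
  rw [integral_prod _ Integrable.of_finite]
  calc ∫ ω, ∫ ω', (stat w ω ω' - n ^ 2 * S) ^ 2 ∂ν ∂ν
      ≤ ∫ ω, (n * (2 * ∑ i, (w i * countDiff ω i) ^ 2 * r i) +
        n ^ 2 * (∑ s, (w (ω s).1 * m (ω s).1 - w (ω s).2 * m (ω s).2) - n * S) ^ 2) ∂ν :=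
        integral_mono Integrable.of_finite Integrable.of_finite inner
    _ = n * (2 * ∫ ω, ∑ i, (w i * countDiff ω i) ^ 2 * r i ∂ν) +
        n ^ 2 * ∫ ω, (∑ s, (w (ω s).1 * m (ω s).1 - w (ω s).2 * m (ω s).2) - n * S) ^ 2 ∂ν := by
        rw [integral_add Integrable.of_finite Integrable.of_finite, integral_const_mul,
          integral_const_mul, integral_const_mul]
    _ ≤ n * (2 * (n * ∑ i, (w i * r i) ^ 2 + n ^ 2 * (b * S))) +
        n ^ 2 * (n * (2 * (b * S))) := by gcongr
    _ = _ := by ring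

/-- The expected weight of `i` is of order `1 / (n (pᵢ + qᵢ))`. -/
lemma integral_weight_mul_le (n : ℕ) (hn : 0 < n) (i : ι) :
    (∫ ω, weight ω i ∂(Measure.pi fun _ : Fin n => p.prod q)) * (p.real {i} + q.real {i}) ≤
      12 / n := by
  set ν := Measure.pi fun _ : Fin n => p.prod q
  set e : ι × ι → ℝ := fun z => if z.1 = i ∨ z.2 = i then 1 else 0 with he
  set ρ := ∫ z, e z ∂(p.prod q) with hρ
  have hn' : (0 : ℝ) < n := by exact_mod_cast hn
  have hmarg : ∫ z : ι × ι, ((if z.1 = i then (1 : ℝ) else 0) + if z.2 = i then 1 else 0)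
      ∂(p.prod q) = p.real {i} + q.real {i} := by
    rw [integral_add Integrable.of_finite Integrable.of_finite,
      integral_fun_fst (fun j => if j = i then (1 : ℝ) else 0),
      integral_fun_snd (fun j => if j = i then (1 : ℝ) else 0),
      integral_fintype Integrable.of_finite, integral_fintype Integrable.of_finite]
    simp
  -- A pair containing `i` twice is counted once in `ρ`; this costs a factor of at most 2.
  have hle : p.real {i} + q.real {i} ≤ 2 * ρ := by
    rw [← hmarg, hρ, ← integral_const_mul]
    refine integral_mono Integrable.of_finite Integrable.of_finite fun z => ?_
    simp only [he]
    split_ifs <;> simp_all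
    norm_num
  have hsq : ∫ z, e z ^ 2 ∂(p.prod q) = ρ := by
    rw [hρ]; congr 1; ext z; simp only [he]; split_ifs <;> norm_num
  have hr0 : 0 ≤ p.real {i} + q.real {i} := by positivity
  rcases hr0.eq_or_lt with h0 | h0
  · rw [← h0, mul_zero]; positivity
  have hρ0 : 0 < ρ := by linarith
  -- Either the hit count reaches half its mean, and the first term dominates, or it deviates by
  -- more than half the mean, and the second term exceeds 1. The second moment then replaces an
  -- exact binomial computation.
  have hpt (ω : Fin n → ι × ι) :
      weight ω i ≤ 2 / (n * ρ) + 4 / (n * ρ) ^ 2 * (∑ s, e (ω s) - n * ρ) ^ 2 := by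
    have ha := hitCount_nonneg ω i
    have hw1 := weight_le_one ω i
    have hN : 0 < n * ρ := by positivity
    change weight ω i ≤ 2 / (n * ρ) + 4 / (n * ρ) ^ 2 * (hitCount ω i - n * ρ) ^ 2
    generalize n * ρ = N at hN
    by_cases hc : N / 2 ≤ hitCount ω i
    · have h1 : weight ω i ≤ 2 / N := by
        rw [weight, inv_eq_one_div, div_le_div_iff₀ (by positivity) hN]; linarith
      have : 0 ≤ 4 / N ^ 2 * (hitCount ω i - N) ^ 2 := by positivity
      linarith
    · have h1 : 1 ≤ 4 / N ^ 2 * (hitCount ω i - N) ^ 2 := by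
        rw [div_mul_eq_mul_div, le_div_iff₀ (by positivity)]
        nlinarith
      have : 0 ≤ 2 / N := by positivity
      linarith
  have hint : ∫ ω, weight ω i ∂ν ≤ 6 / (n * ρ) := by
    calc ∫ ω, weight ω i ∂ν
        ≤ ∫ ω, (2 / (n * ρ) + 4 / (n * ρ) ^ 2 * (∑ s, e (ω s) - n * ρ) ^ 2) ∂ν :=
          integral_mono Integrable.of_finite Integrable.of_finite hpt
      _ = 2 / (n * ρ) + 4 / (n * ρ) ^ 2 * ∫ ω, (∑ s, e (ω s) - n * ρ) ^ 2 ∂ν := by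
          rw [integral_add Integrable.of_finite Integrable.of_finite, integral_const_mul]
          simp
      _ ≤ 2 / (n * ρ) + 4 / (n * ρ) ^ 2 * (n * ρ) := by
          gcongr
          have := integral_iid_sum_sub_sq_le (p.prod q) n e (n * ρ)
          rwa [hsq, ← hρ, sub_self, zero_pow two_ne_zero, add_zero] at this
      _ = 6 / (n * ρ) := by field_simp; norm_num
  calc (∫ ω, weight ω i ∂ν) * (p.real {i} + q.real {i})
      ≤ 6 / (n * ρ) * (2 * ρ) := by gcongr
    _ = 12 / n := by field_simp; norm_num

/-- Markov's inequality for the collision mass after flattening. -/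
lemma measureReal_flattening_fails_le (n : ℕ) (hn : 0 < n) :
    (Measure.pi fun _ : Fin n => p.prod q).real
      {ω | 216 / (n : ℝ) ≤ ∑ i, (weight ω i * (p.real {i} + q.real {i})) ^ 2} ≤ 1 / 9 := by
  set ν := Measure.pi fun _ : Fin n => p.prod q
  have hn' : (0 : ℝ) < n := by exact_mod_cast hn
  have hE : ∫ ω, ∑ i, (weight ω i * (p.real {i} + q.real {i})) ^ 2 ∂ν ≤ 24 / n := by
    rw [integral_finsetSum _ fun _ _ => Integrable.of_finite]
    calc ∑ i, ∫ ω, (weight ω i * (p.real {i} + q.real {i})) ^ 2 ∂ν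
        ≤ ∑ i, ∫ ω, weight ω i * (p.real {i} + q.real {i}) ^ 2 ∂ν := by
          refine Finset.sum_le_sum fun i _ =>
            integral_mono Integrable.of_finite Integrable.of_finite fun ω => ?_
          dsimp only
          rw [mul_pow]
          gcongr
          -- `w² ≤ w` because `0 < w ≤ 1`; only the first moment of the weight is needed.
          nlinarith [weight_pos ω i, weight_le_one ω i]
      _ = ∑ i, (∫ ω, weight ω i ∂ν) * (p.real {i} + q.real {i}) * (p.real {i} + q.real {i}) := by
          refine Finset.sum_congr rfl fun i _ => ?_
          rw [integral_mul_const]; ring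
      _ ≤ ∑ i, 12 / n * (p.real {i} + q.real {i}) := by
          gcongr with i
          exact integral_weight_mul_le p q n hn i
      _ = 24 / n := by
          rw [← Finset.mul_sum, sum_real_singleton]; ring
  have hM := mul_meas_ge_le_integral_of_nonneg (μ := ν)
    (f := fun ω => ∑ i, (weight ω i * (p.real {i} + q.real {i})) ^ 2)
    (Filter.Eventually.of_forall fun ω => Finset.sum_nonneg fun i _ => sq_nonneg _)
    Integrable.of_finite (216 / n)
  have h2 := hM.trans hE
  rw [div_mul_eq_mul_div, div_le_div_iff_of_pos_right hn'] at h2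
  linarith

/-- The rejection region of the `ℓ₁`-closeness tester on a finite domain. -/
def rejectSet (ι : Type*) [Fintype ι] [DecidableEq ι] (n : ℕ) (D : ℝ) :
    Set ((Fin n → ι × ι) × ((Fin n → ι × ι) × (Fin n → ι × ι))) :=
  {ω | n / (40 * D ^ 2) < stat (weight ω.1) ω.2.1 ω.2.2}

/-- Chebyshev's inequality for weights whose flattening succeeded. The bound on the sum of squares
serves twice: directly in the first variance term, and through each single summand as the uniform
bound `b`. -/
lemma measureReal_stat_deviation_le (n : ℕ) (hn : 0 < n) (w : ι → ℝ) (hw : ∀ i, 0 ≤ w i)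
    (hB : ∑ i, (w i * (p.real {i} + q.real {i})) ^ 2 ≤ 216 / n) (t : ℝ) (ht : 0 < t) :
    ((Measure.pi fun _ : Fin n => p.prod q).prod (Measure.pi fun _ : Fin n => p.prod q)).real
      {ω | t ≤ |stat w ω.1 ω.2 - n ^ 2 * ∑ i, w i * (p.real {i} - q.real {i}) ^ 2|} ≤
      (432 * n + 60 * n ^ 3 / √n * ∑ i, w i * (p.real {i} - q.real {i}) ^ 2) / t ^ 2 := by
  have hn' : (0 : ℝ) < n := by exact_mod_cast hn
  set S := ∑ i, w i * (p.real {i} - q.real {i}) ^ 2 with hS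
  have hS0 : 0 ≤ S := Finset.sum_nonneg fun i _ => mul_nonneg (hw i) (sq_nonneg _)
  have hb (i) : w i * (p.real {i} + q.real {i}) ≤ 15 / √n := by
    have h1 : (w i * (p.real {i} + q.real {i})) ^ 2 ≤ (15 / √n) ^ 2 := by
      refine (Finset.single_le_sum (f := fun i => (w i * (p.real {i} + q.real {i})) ^ 2)
        (fun i _ => sq_nonneg _) (Finset.mem_univ i)).trans (hB.trans ?_)
      rw [div_pow, Real.sq_sqrt hn'.le]
      -- `216 ≤ 15²`.
      gcongr; norm_num
    exact (abs_le_of_sq_le_sq' h1 (by positivity)).2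
  have h := integral_stat_sub_sq_le p q n w hw _ hb S hS
  have hM := mul_meas_ge_le_integral_of_nonneg
    (μ := (Measure.pi fun _ : Fin n => p.prod q).prod (Measure.pi fun _ : Fin n => p.prod q))
    (f := fun ω => (stat w ω.1 ω.2 - n ^ 2 * S) ^ 2)
    (Filter.Eventually.of_forall fun ω => sq_nonneg _) Integrable.of_finite (t ^ 2)
  rw [le_div_iff₀' (by positivity)]
  have hset : {ω : (Fin n → ι × ι) × (Fin n → ι × ι) | t ≤ |stat w ω.1 ω.2 - n ^ 2 * S|} =
      {ω | t ^ 2 ≤ (stat w ω.1 ω.2 - n ^ 2 * S) ^ 2} := by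
    ext ω
    simp only [Set.mem_ofPred_eq]
    rw [sq_le_sq, abs_of_pos ht]
  rw [hset]
  refine hM.trans (h.trans ?_)
  refine add_le_add ?_ (le_of_eq (by ring))
  calc 2 * (n : ℝ) ^ 2 * ∑ i, (w i * (p.real {i} + q.real {i})) ^ 2
      ≤ 2 * (n : ℝ) ^ 2 * (216 / n) := by gcongr
    _ = 432 * (n : ℝ) := by field_simp; norm_num

/-- Completeness of the finite closeness tester. -/
theorem measureReal_rejectSet_le (n : ℕ) (D : ℝ) (hD : 0 < D) (hn : 10 ^ 12 * D ^ 4 ≤ n) :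
    ((Measure.pi fun _ : Fin n => p.prod p).prod ((Measure.pi fun _ : Fin n => p.prod p).prod
      (Measure.pi fun _ : Fin n => p.prod p))).real (rejectSet ι n D) ≤ 2 / 9 := by
  have hn' : (0 : ℝ) < n := lt_of_lt_of_le (by positivity) hn
  have hn0 : 0 < n := by exact_mod_cast hn'
  refine (measureReal_prod_le_add (a := 1 / 9) (b := 1 / 9)
    (G := {ω | ¬ 216 / (n : ℝ) ≤ ∑ i, (weight ω i * (p.real {i} + p.real {i})) ^ 2})
    _ _ (Set.toFinite _).measurableSet (by norm_num) ?_ ?_).trans (by norm_num)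
  · simpa [Set.compl_ofPred] using measureReal_flattening_fails_le p p n hn0
  · intro ω hω
    have h := measureReal_stat_deviation_le p p n hn0 (weight ω) (fun i => (weight_pos ω i).le)
      (not_le.1 hω).le (n / (40 * D ^ 2)) (by positivity)
    simp only [sub_self, ne_eq, OfNat.ofNat_ne_zero, not_false_eq_true, zero_pow, mul_zero,
      Finset.sum_const_zero, sub_zero, add_zero] at h
    refine (measureReal_mono ?_).trans (h.trans ?_)
    · intro η hη
      have hη' : n / (40 * D ^ 2) < stat (weight ω) η.1 η.2 := hη
      exact hη'.le.trans (le_abs_self _)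
    · rw [div_pow, div_div_eq_mul_div, div_le_div_iff₀ (by positivity) (by norm_num)]
      nlinarith [mul_le_mul_of_nonneg_left hn (Nat.cast_nonneg (α := ℝ) n)]

/-- Soundness of the finite closeness tester. -/
theorem measureReal_rejectSet_compl_le (n : ℕ) (D : ℝ) (hD : 1 ≤ D) (hn : 10 ^ 12 * D ^ 4 ≤ n)
    (hcard : Fintype.card ι ≤ n + 1)
    (hfar : 1 / (2 * D) ≤ ∑ i, |p.real {i} - q.real {i}|) :
    ((Measure.pi fun _ : Fin n => p.prod q).prod ((Measure.pi fun _ : Fin n => p.prod q).prod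
      (Measure.pi fun _ : Fin n => p.prod q))).real (rejectSet ι n D)ᶜ ≤ 2 / 9 := by
  have hn' : (0 : ℝ) < n := lt_of_lt_of_le (by positivity) hn
  have hn0 : 0 < n := by exact_mod_cast hn'
  refine (measureReal_prod_le_add (a := 1 / 9) (b := 1 / 9)
    (G := {ω | ¬ 216 / (n : ℝ) ≤ ∑ i, (weight ω i * (p.real {i} + q.real {i})) ^ 2})
    _ _ (Set.toFinite _).measurableSet (by norm_num) ?_ ?_).trans (by norm_num)
  · simpa [Set.compl_ofPred] using measureReal_flattening_fails_le p q n hn0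
  · intro ω hω
    set S := ∑ i, weight ω i * (p.real {i} - q.real {i}) ^ 2 with hSdef
    have hS : 1 / (16 * D ^ 2 * n) ≤ S := by
      have h1 := sq_sum_abs_le ω (fun i => p.real {i} - q.real {i})
      have h2 : (1 / (2 * D)) ^ 2 ≤ (∑ i, |p.real {i} - q.real {i}|) ^ 2 := by gcongr
      -- The hits of the flattening block contribute `2n` and the cells at most `n + 1`, so having
      -- as many cells as cover points costs only a constant.
      have h3 : (Fintype.card ι + 2 * n : ℝ) ≤ 4 * n := by
        have : (Fintype.card ι : ℝ) ≤ n + 1 := by exact_mod_cast hcard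
        have : (1 : ℝ) ≤ n := by exact_mod_cast hn0
        linarith
      have hS0 : 0 ≤ S := Finset.sum_nonneg fun i _ => by have := weight_pos ω i; positivity
      have h4 : (1 / (2 * D)) ^ 2 ≤ S * (4 * n) := h2.trans (h1.trans (by gcongr))
      have h5 : 1 / (16 * D ^ 2 * n) = (1 / (2 * D)) ^ 2 / (4 * n) := by field_simp; norm_num
      rw [h5, div_le_iff₀ (by positivity)]
      exact h4
    have hSpos : 0 < S := lt_of_lt_of_le (by positivity) hS
    have h := measureReal_stat_deviation_le p q n hn0 (weight ω) (fun i => (weight_pos ω i).le)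
      (not_le.1 hω).le (n ^ 2 * S / 2) (by positivity)
    rw [← hSdef] at h
    refine (measureReal_mono ?_).trans (h.trans ?_)
    · intro η hη
      have hη' : stat (weight ω) η.1 η.2 ≤ n / (40 * D ^ 2) := not_lt.1 hη
      -- Half the mean is at least `n/(32D²)`, which is above the threshold: acceptance forces a
      -- deviation of half the mean.
      have : n / (40 * D ^ 2) ≤ n ^ 2 * S / 2 := by
        calc n / (40 * D ^ 2) ≤ n ^ 2 * (1 / (16 * D ^ 2 * n)) / 2 := by
              have : (n : ℝ) ^ 2 * (1 / (16 * D ^ 2 * n)) / 2 = n / (32 * D ^ 2) := by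
                field_simp; norm_num
              rw [this]; gcongr; norm_num
          _ ≤ _ := by gcongr
      simp only [Set.mem_ofPred_eq]
      rw [abs_sub_comm]
      refine le_trans ?_ (le_abs_self _)
      linarith
    · have hs : 10 ^ 6 * D ^ 2 ≤ √n := by
        apply Real.le_sqrt_of_sq_le
        calc (10 ^ 6 * D ^ 2) ^ 2 = (10 : ℝ) ^ 12 * D ^ 4 := by ring
          _ ≤ (n : ℝ) := hn
      set r := √(n : ℝ) with hr
      have hrn : (n : ℝ) = r ^ 2 := (Real.sq_sqrt hn'.le).symm
      have hr0 : 0 < r := lt_of_lt_of_le (by positivity) hs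
      have hx : 62500 ≤ r * (n * S) := by
        calc (62500 : ℝ) = 10 ^ 6 * D ^ 2 * (n * (1 / (16 * D ^ 2 * n))) := by field_simp; norm_num
          _ ≤ r * (n * S) := by gcongr
      rw [div_le_div_iff₀ (by positivity) (by norm_num)]
      rw [hrn] at hx ⊢
      -- In `y = n^(3/2) S` the Chebyshev bound becomes `3888 + 540y ≤ y²/4`, ample for `y ≥ 62500 =
      -- 10⁶/16`.
      set y := r * (r ^ 2 * S) with hy
      have e1 : (432 * r ^ 2 + 60 * (r ^ 2) ^ 3 / r * S) * 9 = r ^ 2 * (3888 + 540 * y) := by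
        rw [hy]; field_simp; ring
      have e2 : 1 * ((r ^ 2) ^ 2 * S / 2) ^ 2 = r ^ 2 * (y ^ 2 / 4) := by rw [hy]; ring
      rw [e1, e2]
      gcongr
      nlinarith

end FiniteDomain

/-! ### Bounding EMD by a coupling that respects a finite partition -/

section Coupling

variable {X : Type*} [MeasurableSpace X] {ι : Type*} [Fintype ι]

/-- The part of `p` left over after the cells of `φ` are matched with `q`. -/
def residual (p q : Measure X) (φ : X → ι) : Measure X :=
  ∑ i, ((p (φ ⁻¹' {i}) - q (φ ⁻¹' {i})) / p (φ ⁻¹' {i})) • p.restrict (φ ⁻¹' {i})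

lemma residual_apply (p q : Measure X) (φ : X → ι) {s : Set X} (hs : MeasurableSet s) :
    residual p q φ s =
      ∑ i, (p (φ ⁻¹' {i}) - q (φ ⁻¹' {i})) / p (φ ⁻¹' {i}) * p (s ∩ φ ⁻¹' {i}) := by
  simp [residual, Measure.finsetSum_apply, Measure.restrict_apply hs]

lemma residual_univ (p q : Measure X) [IsFiniteMeasure p] (φ : X → ι) :
    residual p q φ Set.univ = ∑ i, (p (φ ⁻¹' {i}) - q (φ ⁻¹' {i})) := by
  rw [residual_apply p q φ MeasurableSet.univ]
  refine Finset.sum_congr rfl fun i _ => ?_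
  rw [Set.univ_inter]
  by_cases h : p (φ ⁻¹' {i}) = 0
  · simp [h]
  · exact ENNReal.div_mul_cancel h (measure_ne_top _ _)

lemma residual_apply_eq_zero (p q : Measure X) (φ : X → ι) {s : Set X} (hs : p s = 0) :
    residual p q φ s = 0 := by
  simp only [residual, Measure.finsetSum_apply, Measure.smul_apply, smul_eq_mul,
    Finset.sum_eq_zero_iff, mul_eq_zero]
  exact fun i _ => Or.inr (le_antisymm ((Measure.restrict_apply_le _ _).trans hs.le) zero_le)

instance (p q : Measure X) [IsFiniteMeasure p] (φ : X → ι) :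
    IsFiniteMeasure (residual p q φ) :=
  ⟨by
    rw [residual_univ]
    exact ENNReal.sum_lt_top.2 fun i _ => tsub_le_self.trans_lt (measure_lt_top _ _)⟩

variable [MeasurableSpace ι] [MeasurableSingletonClass ι]

lemma sum_measure_inter_fiber (p : Measure X) {φ : X → ι} (hφ : Measurable φ) {s : Set X}
    (hs : MeasurableSet s) : ∑ i, p (s ∩ φ ⁻¹' {i}) = p s := by
  rw [← measure_biUnion_finset (fun i _ j _ hij => ?_)
    (fun i _ => hs.inter (hφ (measurableSet_singleton i)))]
  · congr 1; ext x; simp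
  · refine Set.disjoint_left.2 fun x hx hx' => hij ?_
    rw [← hx.2, ← hx'.2]

lemma matched_add_residual (p q : Measure X) [IsFiniteMeasure p] {φ : X → ι} (hφ : Measurable φ)
    {s : Set X} (hs : MeasurableSet s) :
    ∑ i, min (p (φ ⁻¹' {i})) (q (φ ⁻¹' {i})) / p (φ ⁻¹' {i}) * p (s ∩ φ ⁻¹' {i})
      + residual p q φ s = p s := by
  rw [residual_apply p q φ hs, ← Finset.sum_add_distrib, ← sum_measure_inter_fiber p hφ hs]
  refine Finset.sum_congr rfl fun i _ => ?_
  by_cases h : p (φ ⁻¹' {i}) = 0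
  · simp [measure_mono_null Set.inter_subset_right h]
  · have : min (p (φ ⁻¹' {i})) (q (φ ⁻¹' {i})) + (p (φ ⁻¹' {i}) - q (φ ⁻¹' {i}))
        = p (φ ⁻¹' {i}) := by
      rcases le_total (p (φ ⁻¹' {i})) (q (φ ⁻¹' {i})) with h' | h'
      · rw [min_eq_left h', tsub_eq_zero_of_le h', add_zero]
      · rw [min_eq_right h', add_tsub_cancel_of_le h']
    rw [← add_mul, ENNReal.div_add_div_same, this, ENNReal.div_self h (measure_ne_top _ _),
      one_mul]

/-- Both residual masses complete the same matched mass `Σ min` to 1. Equality is what lets one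
normalising factor serve both marginals of the residual product. -/
lemma residual_univ_comm (p q : Measure X) [IsProbabilityMeasure p] [IsProbabilityMeasure q]
    {φ : X → ι} (hφ : Measurable φ) :
    residual p q φ Set.univ = residual q p φ Set.univ := by
  have key (p q : Measure X) [IsProbabilityMeasure p] :
      ∑ i, min (p (φ ⁻¹' {i})) (q (φ ⁻¹' {i})) + residual p q φ Set.univ = 1 := by
    rw [← measure_univ (μ := p), ← matched_add_residual p q hφ MeasurableSet.univ]
    congr 1
    refine Finset.sum_congr rfl fun i _ => ?_
    rw [Set.univ_inter]
    by_cases h : p (φ ⁻¹' {i}) = 0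
    · simp [h]
    · exact (ENNReal.div_mul_cancel h (measure_ne_top _ _)).symm
  have h1 := key p q
  have h2 := key q p
  simp only [min_comm (q _)] at h2
  refine (ENNReal.add_right_inj ?_).1 (h1.trans h2.symm)
  exact ne_top_of_le_ne_top ENNReal.one_ne_top (h1 ▸ le_self_add)

/-- Inside each cell of `φ` as much mass as possible is matched, and the rest is matched
arbitrarily. -/
def cellCoupling (p q : Measure X) (φ : X → ι) : Measure (X × X) :=
  ∑ i, (min (p (φ ⁻¹' {i})) (q (φ ⁻¹' {i})) / p (φ ⁻¹' {i}) / q (φ ⁻¹' {i})) •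
      (p.restrict (φ ⁻¹' {i})).prod (q.restrict (φ ⁻¹' {i}))
    + (residual p q φ Set.univ)⁻¹ • (residual p q φ).prod (residual q p φ)

variable (p q : Measure X) [IsProbabilityMeasure p] [IsProbabilityMeasure q] {φ : X → ι}

lemma cellCoupling_fst (hφ : Measurable φ) : (cellCoupling p q φ).fst = p := by
  ext s hs
  rw [Measure.fst_apply hs, ← Set.prod_univ, ← matched_add_residual p q hφ hs]
  simp only [cellCoupling, Measure.add_apply, Measure.finsetSum_apply, Measure.smul_apply,
    smul_eq_mul, Measure.prod_prod, Measure.restrict_apply hs, Measure.restrict_apply_univ]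
  congr 1
  · refine Finset.sum_congr rfl fun i _ => ?_
    -- On a cell null for `q` the minimum vanishes, so division by zero does no harm.
    by_cases h : q (φ ⁻¹' {i}) = 0
    · simp [h]
    · rw [mul_comm (p _), ← mul_assoc, ENNReal.div_mul_cancel h (measure_ne_top _ _)]
  · rw [← residual_univ_comm p q hφ, mul_comm (residual p q φ s), ← mul_assoc]
    -- If nothing is left over, the factor is `∞` but multiplies a zero measure.
    by_cases h : residual p q φ Set.univ = 0
    · simp [measure_mono_null (Set.subset_univ s) h]
    · rw [ENNReal.inv_mul_cancel h (measure_ne_top _ _), one_mul]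

lemma cellCoupling_snd (hφ : Measurable φ) : (cellCoupling p q φ).snd = q := by
  ext s hs
  rw [Measure.snd_apply hs, ← Set.univ_prod, ← matched_add_residual q p hφ hs]
  simp only [cellCoupling, Measure.add_apply, Measure.finsetSum_apply, Measure.smul_apply,
    smul_eq_mul, Measure.prod_prod, Measure.restrict_apply hs, Measure.restrict_apply_univ]
  congr 1
  · refine Finset.sum_congr rfl fun i _ => ?_
    rw [min_comm]
    by_cases h : p (φ ⁻¹' {i}) = 0
    · simp [h]
    · calc _ = min (q (φ ⁻¹' {i})) (p (φ ⁻¹' {i})) / q (φ ⁻¹' {i}) * q (s ∩ φ ⁻¹' {i}) *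
            ((p (φ ⁻¹' {i}))⁻¹ * p (φ ⁻¹' {i})) := by simp only [div_eq_mul_inv]; ring
        _ = _ := by rw [ENNReal.inv_mul_cancel h (measure_ne_top _ _), mul_one]
  · rw [← mul_assoc]
    by_cases h : residual p q φ Set.univ = 0
    · have h' := h
      rw [residual_univ_comm p q hφ] at h'
      simp [measure_mono_null (Set.subset_univ s) h']
    · rw [ENNReal.inv_mul_cancel h (measure_ne_top _ _), one_mul]

lemma lintegral_edist_prod_le {X : Type*} [PseudoEMetricSpace X] [MeasurableSpace X]
    (μ ν : Measure X) [SFinite μ] [SFinite ν] {S T : Set X} (hS : μ Sᶜ = 0) (hT : ν Tᶜ = 0)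
    {M : ℝ≥0∞} (hM : ∀ x ∈ S, ∀ y ∈ T, edist x y ≤ M) :
    ∫⁻ z, edist z.1 z.2 ∂(μ.prod ν) ≤ M * (μ Set.univ * ν Set.univ) := by
  have hae : ∀ᵐ z ∂(μ.prod ν), edist z.1 z.2 ≤ M := by
    have h1 : ∀ᵐ z ∂(μ.prod ν), z.1 ∈ S := Measure.quasiMeasurePreserving_fst.ae hS
    have h2 : ∀ᵐ z ∂(μ.prod ν), z.2 ∈ T := Measure.quasiMeasurePreserving_snd.ae hT
    filter_upwards [h1, h2] with z hz1 hz2 using hM _ hz1 _ hz2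
  refine (lintegral_mono_ae hae).trans ?_
  rw [lintegral_const, ← Set.univ_prod_univ, Measure.prod_prod]

/-- An upper bound on the Earth Mover's Distance through a finite measurable partition. -/
theorem EMD_le_of_partition {X : Type*} [PseudoEMetricSpace X] [MeasurableSpace X]
    (p q : Measure X) [IsProbabilityMeasure p] [IsProbabilityMeasure q] {φ : X → ι}
    (hφ : Measurable φ) {Q : Set X} (hp : p Qᶜ = 0) (hq : q Qᶜ = 0) {M : ℝ≥0∞}
    (hM : ∀ x ∈ Q, ∀ y ∈ Q, edist x y ≤ M) {R : ι → ℝ≥0∞}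
    (hR : ∀ x ∈ Q, ∀ y ∈ Q, φ x = φ y → edist x y ≤ R (φ x)) :
    EMD p q ≤ ∑ i, R i * min (p (φ ⁻¹' {i})) (q (φ ⁻¹' {i})) +
      M * ∑ i, (p (φ ⁻¹' {i}) - q (φ ⁻¹' {i})) := by
  refine (iInf_le _ ⟨cellCoupling p q φ, cellCoupling_fst p q hφ, cellCoupling_snd p q hφ⟩).trans ?_
  simp only [cellCoupling]
  rw [lintegral_add_measure, lintegral_finsetSum_measure]
  refine add_le_add (Finset.sum_le_sum fun i _ => ?_) ?_
  · have hmeas : MeasurableSet (φ ⁻¹' {i}) := hφ (measurableSet_singleton i)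
    have hnull (μ : Measure X) (hμ : μ Qᶜ = 0) : μ.restrict (φ ⁻¹' {i}) (Q ∩ φ ⁻¹' {i})ᶜ = 0 := by
      rw [Measure.restrict_apply' hmeas]
      refine measure_mono_null ?_ hμ
      rintro x ⟨hx, hx'⟩ hQ
      exact hx ⟨hQ, hx'⟩
    rw [lintegral_smul_measure, smul_eq_mul]
    calc _ ≤ min (p (φ ⁻¹' {i})) (q (φ ⁻¹' {i})) / p (φ ⁻¹' {i}) / q (φ ⁻¹' {i}) *
          (R i * (p (φ ⁻¹' {i}) * q (φ ⁻¹' {i}))) := by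
          gcongr
          have := lintegral_edist_prod_le (p.restrict (φ ⁻¹' {i})) (q.restrict (φ ⁻¹' {i}))
            (hnull p hp) (hnull q hq) (M := R i) (fun x hx y hy => by
              have h1 : φ x = i := hx.2
              have h2 : φ y = i := hy.2
              rw [← h1]
              exact hR x hx.1 y hy.1 (h1.trans h2.symm))
          simpa only [Measure.restrict_apply_univ] using this
      _ ≤ R i * (min (p (φ ⁻¹' {i})) (q (φ ⁻¹' {i}))) := by
          calc _ = R i * (min (p (φ ⁻¹' {i})) (q (φ ⁻¹' {i})) / p (φ ⁻¹' {i}) *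
                p (φ ⁻¹' {i}) / q (φ ⁻¹' {i}) * q (φ ⁻¹' {i})) := by
                simp only [div_eq_mul_inv]; ring
            _ ≤ _ := by
                gcongr
                exact (ENNReal.mul_le_of_le_div le_rfl).trans (ENNReal.mul_le_of_le_div le_rfl)
  · rw [lintegral_smul_measure, smul_eq_mul, ← residual_univ p q φ]
    calc _ ≤ (residual p q φ Set.univ)⁻¹ *
          (M * (residual p q φ Set.univ * residual q p φ Set.univ)) := by
          gcongr
          exact lintegral_edist_prod_le _ _ (residual_apply_eq_zero p q φ hp)
            (residual_apply_eq_zero q p φ hq) hM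
      _ = M * (residual q p φ Set.univ / residual p q φ Set.univ * residual p q φ Set.univ) := by
          simp only [div_eq_mul_inv]; ring
      _ ≤ M * residual q p φ Set.univ := by
          gcongr
          exact ENNReal.mul_le_of_le_div le_rfl
      _ = _ := by rw [residual_univ_comm p q hφ]

/-- Half of the `ℓ₁` distance is the total positive part. -/
lemma sum_measure_sub_eq (μ ν : Measure ι) [IsProbabilityMeasure μ] [IsProbabilityMeasure ν] :
    ∑ i, (μ {i} - ν {i}) = ENNReal.ofReal ((∑ i, |μ.real {i} - ν.real {i}|) / 2) := by
  have h (i) : μ {i} - ν {i} = ENNReal.ofReal (max (μ.real {i} - ν.real {i}) 0) := by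
    rw [ENNReal.ofReal_max, ENNReal.ofReal_zero, max_eq_left zero_le,
      ENNReal.ofReal_sub _ measureReal_nonneg, ofReal_measureReal, ofReal_measureReal]
  simp only [h]
  rw [← ENNReal.ofReal_sum_of_nonneg fun i _ => le_max_right _ _]
  congr 1
  have hz : ∑ i, (μ.real {i} - ν.real {i}) = 0 := by
    rw [Finset.sum_sub_distrib, sum_measureReal_singleton, sum_measureReal_singleton]
    simp
  have hmax (a : ℝ) : max a 0 = |a| / 2 + a / 2 := by
    rcases le_total a 0 with h | h
    · rw [max_eq_right h, abs_of_nonpos h]; ring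
    · rw [max_eq_left h, abs_of_nonneg h]; ring
  simp only [hmax]
  rw [Finset.sum_add_distrib, ← Finset.sum_div, ← Finset.sum_div, hz]; ring

end Coupling

/-! ### Covering most of the mass by balls around samples -/

section Cover

variable {X : Type*} [PseudoMetricSpace X] {n : ℕ}

/-- The condition is vacuous at `j = n`, so a search for the least `j` always stops, and stops at
`n` exactly on uncovered points. -/
lemma exists_near (r : ℝ) (z : Fin n → X) (x : X) :
    ∃ j : ℕ, ∀ h : j < n, dist x (z ⟨j, h⟩) ≤ r :=
  ⟨n, fun h => absurd h (lt_irrefl n)⟩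

open Classical in
/-- The first index `j` for which `x` is within distance `r` of `z j`, or `Fin.last n` if there is
none. -/
def firstNear (r : ℝ) (z : Fin n → X) (x : X) : Fin (n + 1) :=
  ⟨Nat.find (exists_near r z x), Nat.lt_succ_of_le
    (Nat.find_min' _ fun h => absurd h (lt_irrefl n))⟩

lemma firstNear_eq_last_iff (r : ℝ) (z : Fin n → X) (x : X) :
    firstNear r z x = Fin.last n ↔ ∀ j, r < dist x (z j) := by
  classical
  rw [Fin.ext_iff]
  simp only [firstNear, Fin.val_last]
  rw [Nat.find_eq_iff]
  constructor
  · rintro ⟨-, h⟩ j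
    have := h j j.2
    push Not at this
    exact this.2
  · intro h
    refine ⟨fun h' => absurd h' (lt_irrefl n), fun j hj => ?_⟩
    push Not
    exact ⟨hj, h _⟩

lemma dist_le_of_firstNear_eq {r : ℝ} {z : Fin n → X} {x : X} {j : Fin (n + 1)}
    (hx : firstNear r z x = j) (hj : (j : ℕ) < n) : dist x (z ⟨j, hj⟩) ≤ r := by
  classical
  subst hx
  exact Nat.find_spec (exists_near r z x) hj

lemma dist_le_of_firstNear_eq_firstNear {r : ℝ} {z : Fin n → X} {x y : X}
    (hxy : firstNear r z x = firstNear r z y) (hx : firstNear r z x ≠ Fin.last n) :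
    dist x y ≤ 2 * r := by
  have hj : (firstNear r z x : ℕ) < n := Fin.val_lt_last hx
  have h1 := dist_le_of_firstNear_eq rfl hj
  have h2 := dist_le_of_firstNear_eq hxy.symm hj
  have := dist_triangle_right x y (z ⟨firstNear r z x, hj⟩)
  linarith

variable [MeasurableSpace X] [OpensMeasurableSpace X] [SecondCountableTopology X]

/-- Joint measurability in the centres and the point is needed because the centres are random:
Fubini is applied to both. -/
lemma measurable_firstNear (r : ℝ) :
    Measurable fun a : (Fin n → X) × X => firstNear r a.1 a.2 := by
  classical
  have h : Measurable fun a : (Fin n → X) × X => Nat.find (exists_near r a.1 a.2) := by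
    refine measurable_find _ fun j => ?_
    by_cases hj : j < n
    · simp only [hj, forall_true_left]
      exact measurableSet_le (measurable_snd.dist ((measurable_pi_apply _).comp measurable_fst))
        measurable_const
    · simp [hj]
  refine measurable_to_countable' fun j => ?_
  have : (fun a : (Fin n → X) × X => firstNear r a.1 a.2) ⁻¹' {j} =
      (fun a : (Fin n → X) × X => Nat.find (exists_near r a.1 a.2)) ⁻¹' {(j : ℕ)} := by
    ext a
    simp [firstNear, Fin.ext_iff]
  rw [this]
  exact h (measurableSet_singleton _)

/-- Bernoulli gives `nr ≤ (1 + r)^n`, and `(1 - r)^n (1 + r)^n ≤ 1`. -/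
lemma mul_one_sub_pow_le {r : ℝ} (h0 : 0 ≤ r) (h1 : r ≤ 1) (hn : 0 < n) :
    r * (1 - r) ^ n ≤ 1 / n := by
  have hn' : (0 : ℝ) < n := by exact_mod_cast hn
  rw [le_div_iff₀ hn']
  have hb : 1 + n * r ≤ (1 + r) ^ n := one_add_mul_le_pow (by linarith) n
  have hm : (1 - r) ^ n * (1 + r) ^ n ≤ 1 := by
    rw [← mul_pow]
    exact pow_le_one₀ (by nlinarith) (by nlinarith)
  have hp : 0 ≤ (1 - r) ^ n := pow_nonneg (by linarith) n
  nlinarith [mul_le_mul_of_nonneg_left hb hp]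

/-- The expected mass not covered by `n` samples. -/
lemma lintegral_uncovered_le (p : Measure X) [IsProbabilityMeasure p] {k : ℕ} {r : ℝ}
    {K : Fin k → Set X} (hK : p (⋃ i, K i)ᶜ = 0) (hdiam : ∀ i, ∀ x ∈ K i, ∀ y ∈ K i, dist x y ≤ r)
    (hn : 0 < n) :
    ∫⁻ z, p (firstNear r z ⁻¹' {Fin.last n}) ∂(Measure.pi fun _ : Fin n => p) ≤
      ENNReal.ofReal (k / n) := by
  have hS : MeasurableSet ((fun a : (Fin n → X) × X => firstNear r a.1 a.2) ⁻¹' {Fin.last n}) :=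
    measurable_firstNear r (measurableSet_singleton _)
  -- By Fubini, ask for each fixed `x` how likely all centres are to miss the ball around it.
  have hswap : ∫⁻ z, p (firstNear r z ⁻¹' {Fin.last n}) ∂(Measure.pi fun _ : Fin n => p) =
      ∫⁻ x, p (Metric.closedBall x r)ᶜ ^ n ∂p := by
    refine (Measure.prod_apply hS).symm.trans ((Measure.prod_apply_symm hS).trans ?_)
    refine lintegral_congr fun x => ?_
    have : (fun z : Fin n → X => (z, x)) ⁻¹'
        ((fun a : (Fin n → X) × X => firstNear r a.1 a.2) ⁻¹' {Fin.last n}) =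
        Set.univ.pi fun _ => (Metric.closedBall x r)ᶜ := by
      ext z
      simp [firstNear_eq_last_iff, dist_comm x]
    rw [this, Measure.pi_pi]
    simp
  -- Clusters need not be measurable; their closures are, with the same diameter bound.
  have hcl (i) : MeasurableSet (closure (K i)) := isClosed_closure.measurableSet
  have hball (i) (x) (hx : x ∈ closure (K i)) : closure (K i) ⊆ Metric.closedBall x r := by
    intro y hy
    have hmem : (y, x) ∈ closure (K i ×ˢ K i) := by rw [closure_prod_eq]; exact ⟨hy, hx⟩
    have hsub : closure (K i ×ˢ K i) ⊆ {a : X × X | dist a.1 a.2 ≤ r} :=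
      closure_minimal (fun a ha => hdiam i _ ha.1 _ ha.2)
        (isClosed_le continuous_dist continuous_const)
    exact hsub hmem
  have hres : p.restrict (⋃ i, closure (K i)) = p := by
    refine Measure.restrict_eq_self_of_ae_mem ?_
    exact measure_mono_null (Set.compl_subset_compl.2 (Set.iUnion_mono fun i => subset_closure)) hK
  rw [hswap]
  calc ∫⁻ x, p (Metric.closedBall x r)ᶜ ^ n ∂p
      = ∫⁻ x in ⋃ i, closure (K i), p (Metric.closedBall x r)ᶜ ^ n ∂p := by rw [hres]
    _ ≤ ∑' i, ∫⁻ x in closure (K i), p (Metric.closedBall x r)ᶜ ^ n ∂p := lintegral_iUnion_le _ _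
    _ ≤ ∑' _i : Fin k, ENNReal.ofReal (1 / n) := by
        refine ENNReal.tsum_le_tsum fun i => ?_
        calc ∫⁻ x in closure (K i), p (Metric.closedBall x r)ᶜ ^ n ∂p
            ≤ ∫⁻ _ in closure (K i), p (closure (K i))ᶜ ^ n ∂p := by
              refine setLIntegral_mono' (hcl i) fun x hx => ?_
              gcongr
              exact hball i x hx
          _ = p (closure (K i))ᶜ ^ n * p (closure (K i)) := by simp
          _ = ENNReal.ofReal (p.real (closure (K i)) * (1 - p.real (closure (K i))) ^ n) := by
              have h1 : 0 ≤ 1 - p.real (closure (K i)) := by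
                linarith [measureReal_le_one (μ := p) (s := closure (K i))]
              rw [ENNReal.ofReal_mul measureReal_nonneg, ENNReal.ofReal_pow h1,
                ← probReal_compl_eq_one_sub (hcl i), ofReal_measureReal, ofReal_measureReal,
                mul_comm]
          _ ≤ ENNReal.ofReal (1 / n) :=
              ENNReal.ofReal_le_ofReal
                (mul_one_sub_pow_le measureReal_nonneg measureReal_le_one hn)
    _ = ENNReal.ofReal (k / n) := by
        rw [tsum_fintype]
        simp only [Finset.sum_const, Finset.card_univ, Fintype.card_fin, nsmul_eq_mul]
        rw [← ENNReal.ofReal_natCast, ← ENNReal.ofReal_mul (by positivity)]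
        congr 1; ring

/-- Markov's inequality for the mass not covered by `n` samples. -/
lemma measureReal_uncovered_le (p : Measure X) [IsProbabilityMeasure p] {k : ℕ} {r : ℝ}
    {K : Fin k → Set X} (hK : p (⋃ i, K i)ᶜ = 0) (hdiam : ∀ i, ∀ x ∈ K i, ∀ y ∈ K i, dist x y ≤ r)
    (hn : 0 < n) {η : ℝ} (hη : 0 < η) :
    (Measure.pi fun _ : Fin n => p).real {z | η ≤ p.real (firstNear r z ⁻¹' {Fin.last n})} ≤
      k / n / η := by
  have hS : MeasurableSet ((fun a : (Fin n → X) × X => firstNear r a.1 a.2) ⁻¹' {Fin.last n}) :=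
    measurable_firstNear r (measurableSet_singleton _)
  have hm : Measurable fun z : Fin n → X => p (firstNear r z ⁻¹' {Fin.last n}) :=
    measurable_measure_prodMk_left hS
  have h := mul_meas_ge_le_lintegral₀ (μ := Measure.pi fun _ : Fin n => p) hm.aemeasurable
    (ENNReal.ofReal η)
  have h2 := h.trans (lintegral_uncovered_le p hK hdiam hn)
  have hset : {z : Fin n → X | η ≤ p.real (firstNear r z ⁻¹' {Fin.last n})} =
      {z | ENNReal.ofReal η ≤ p (firstNear r z ⁻¹' {Fin.last n})} := by
    ext z
    simp only [Set.mem_ofPred_eq]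
    rw [ENNReal.ofReal_le_iff_le_toReal (measure_ne_top _ _), Measure.real]
  rw [hset, le_div_iff₀' hη, Measure.real]
  have h3 := ENNReal.toReal_mono ENNReal.ofReal_ne_top h2
  rwa [ENNReal.toReal_mul, ENNReal.toReal_ofReal hη.le, ENNReal.toReal_ofReal (by positivity)] at h3

end Cover

/-! ### Cutting the samples into independent blocks of pairs -/

section Blocks

variable {Z : Type*} [MeasurableSpace Z]

/-- Splitting a sample of size `m + n` into two consecutive blocks. -/
def splitBlocks (m n : ℕ) (ω : Fin (m + n) → Z) : (Fin m → Z) × (Fin n → Z) :=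
  (fun i => ω (Fin.castAdd n i), fun j => ω (Fin.natAdd m j))

lemma measurePreserving_splitBlocks (P : Measure Z) [SigmaFinite P] (m n : ℕ) :
    MeasurePreserving (splitBlocks m n) (Measure.pi fun _ => P)
      ((Measure.pi fun _ => P).prod (Measure.pi fun _ => P)) :=
  (measurePreserving_sumPiEquivProdPi fun _ : Fin m ⊕ Fin n => P).comp
    ((measurePreserving_piCongrLeft (fun _ => P) finSumFinEquiv).symm _)

/-- Pairing up the two samples and splitting the pairs into four blocks. -/
def pairBlocks (n : ℕ) (s : (Fin (n + (n + (n + n))) → Z) × (Fin (n + (n + (n + n))) → Z)) :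
    (Fin n → Z × Z) × ((Fin n → Z × Z) × ((Fin n → Z × Z) × (Fin n → Z × Z))) :=
  Prod.map id (Prod.map id (splitBlocks n n) ∘ splitBlocks n (n + n))
    (splitBlocks n (n + (n + n)) fun i => (s.1 i, s.2 i))

lemma measurePreserving_pairBlocks (p q : Measure Z) [IsProbabilityMeasure p]
    [IsProbabilityMeasure q] (n : ℕ) :
    MeasurePreserving (pairBlocks n) ((Measure.pi fun _ => p).prod (Measure.pi fun _ => q))
      ((Measure.pi fun _ => p.prod q).prod ((Measure.pi fun _ => p.prod q).prod
        ((Measure.pi fun _ => p.prod q).prod (Measure.pi fun _ => p.prod q)))) := by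
  have h0 := (measurePreserving_arrowProdEquivProdArrow Z Z (Fin (n + (n + (n + n))))
    (fun _ => p) (fun _ => q)).symm
  have h1 := measurePreserving_splitBlocks (p.prod q) n (n + (n + n))
  have h2 := measurePreserving_splitBlocks (p.prod q) n (n + n)
  have h3 := measurePreserving_splitBlocks (p.prod q) n n
  have hid := MeasurePreserving.id (Measure.pi fun _ : Fin n => p.prod q)
  exact (hid.prod ((hid.prod h3).comp h2)).comp (h1.comp h0)

end Blocks

/-! ### The tester on a metric space and its correctness -/

section Tester

variable {X : Type*} [MeasurableSpace X]

/-- Replacing sample points by the indices of their cells. -/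
def relabel {ι : Type*} {n : ℕ} (φ : X → ι) (ω : Fin n → X × X) : Fin n → ι × ι :=
  fun s => (φ (ω s).1, φ (ω s).2)

/-- The points of the first block that the cover is built from. -/
def coverPoints {n : ℕ} (ω : Fin n → X × X) : Fin n → X := fun s => (ω s).1

lemma measurePreserving_relabel {ι : Type*} [MeasurableSpace ι] (p q : Measure X)
    [IsProbabilityMeasure p] [IsProbabilityMeasure q] {φ : X → ι} (hφ : Measurable φ) (n : ℕ) :
    MeasurePreserving (relabel φ) (Measure.pi fun _ : Fin n => p.prod q)
      (Measure.pi fun _ : Fin n => (p.map φ).prod (q.map φ)) := by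
  have := Measure.isProbabilityMeasure_map (μ := p) hφ.aemeasurable
  have := Measure.isProbabilityMeasure_map (μ := q) hφ.aemeasurable
  exact measurePreserving_pi _ _ fun _ =>
    (hφ.measurePreserving p).prod (hφ.measurePreserving q)

lemma measurePreserving_coverPoints (p q : Measure X) [IsProbabilityMeasure p]
    [IsProbabilityMeasure q] (n : ℕ) :
    MeasurePreserving coverPoints (Measure.pi fun _ : Fin n => p.prod q)
      (Measure.pi fun _ : Fin n => p) :=
  measurePreserving_pi _ _ fun _ => measurePreserving_fst

/-- The samples that are rejected: the first block gives the cells, the second one the flattening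
weights, and the other two the statistic. -/
def blockRejectSet (X : Type*) [PseudoMetricSpace X] (n : ℕ) (r D : ℝ) :
    Set ((Fin n → X × X) × ((Fin n → X × X) × ((Fin n → X × X) × (Fin n → X × X)))) :=
  {ω | (relabel (firstNear r (coverPoints ω.1)) ω.2.1,
    relabel (firstNear r (coverPoints ω.1)) ω.2.2.1,
    relabel (firstNear r (coverPoints ω.1)) ω.2.2.2) ∈ rejectSet (Fin (n + 1)) n D}

variable [PseudoMetricSpace X] [OpensMeasurableSpace X] [SecondCountableTopology X]

lemma measurable_relabel_cover (n : ℕ) (r : ℝ) :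
    Measurable fun a : (Fin n → X × X) × (Fin n → X × X) =>
      relabel (firstNear r (coverPoints a.1)) a.2 := by
  have hc : Measurable (coverPoints : (Fin n → X × X) → Fin n → X) :=
    measurable_pi_lambda _ fun s => (measurable_pi_apply s).fst
  refine measurable_pi_lambda _ fun s => Measurable.prodMk ?_ ?_
  · exact (measurable_firstNear r).comp
      ((hc.comp measurable_fst).prodMk ((measurable_pi_apply s).comp measurable_snd).fst)
  · exact (measurable_firstNear r).comp
      ((hc.comp measurable_fst).prodMk ((measurable_pi_apply s).comp measurable_snd).snd)

lemma measurableSet_blockRejectSet (n : ℕ) (r D : ℝ) :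
    MeasurableSet (blockRejectSet X n r D) := by
  have h := measurable_relabel_cover (X := X) n r
  have hm : Measurable fun ω : (Fin n → X × X) ×
      ((Fin n → X × X) × ((Fin n → X × X) × (Fin n → X × X))) =>
      (relabel (firstNear r (coverPoints ω.1)) ω.2.1,
        relabel (firstNear r (coverPoints ω.1)) ω.2.2.1,
        relabel (firstNear r (coverPoints ω.1)) ω.2.2.2) :=
    (h.comp (measurable_fst.prodMk measurable_snd.fst)).prodMk
      ((h.comp (measurable_fst.prodMk measurable_snd.snd.fst)).prodMk
        (h.comp (measurable_fst.prodMk measurable_snd.snd.snd)))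
  exact hm (Set.toFinite _).measurableSet

/-- The conditional law of the decision, given the first block. -/
lemma measureReal_section_blockRejectSet (p q : Measure X) [IsProbabilityMeasure p]
    [IsProbabilityMeasure q] (n : ℕ) (r : ℝ)
    (A : Set ((Fin n → Fin (n + 1) × Fin (n + 1)) ×
      ((Fin n → Fin (n + 1) × Fin (n + 1)) × (Fin n → Fin (n + 1) × Fin (n + 1)))))
    (z : Fin n → X) :
    ((Measure.pi fun _ : Fin n => p.prod q).prod ((Measure.pi fun _ : Fin n => p.prod q).prod
      (Measure.pi fun _ : Fin n => p.prod q))).real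
      {ω | (relabel (firstNear r z) ω.1, relabel (firstNear r z) ω.2.1,
        relabel (firstNear r z) ω.2.2) ∈ A} =
    ((Measure.pi fun _ : Fin n => (p.map (firstNear r z)).prod (q.map (firstNear r z))).prod
      ((Measure.pi fun _ : Fin n => (p.map (firstNear r z)).prod (q.map (firstNear r z))).prod
      (Measure.pi fun _ : Fin n => (p.map (firstNear r z)).prod (q.map (firstNear r z))))).real
      A := by
  have hφ : Measurable (firstNear r z) := (measurable_firstNear r).comp measurable_prodMk_left
  have := Measure.isProbabilityMeasure_map (μ := p) hφ.aemeasurable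
  have := Measure.isProbabilityMeasure_map (μ := q) hφ.aemeasurable
  have h := measurePreserving_relabel p q hφ n
  exact (h.prod (h.prod h)).measureReal_preimage (Set.toFinite A).measurableSet.nullMeasurableSet

/-- Distributions that are far in EMD give far distributions on the cells, if most of the mass of
`p` is covered. -/
lemma le_sum_abs_of_lt_EMD (p q : Measure X) [IsProbabilityMeasure p] [IsProbabilityMeasure q]
    {Q : Set X} (hp : p Qᶜ = 0) (hq : q Qᶜ = 0) {ε D : ℝ} (hε : 0 < ε) (hD : 0 < D)
    (hQ : ∀ x ∈ Q, ∀ y ∈ Q, dist x y ≤ D * ε) (hfar : ENNReal.ofReal ε < EMD p q) {n : ℕ}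
    (z : Fin n → X)
    (hz : p.real (firstNear (ε / 4) z ⁻¹' {Fin.last n}) ≤ 1 / (4 * D)) :
    1 / (2 * D) ≤ ∑ i, |(p.map (firstNear (ε / 4) z)).real {i} -
      (q.map (firstNear (ε / 4) z)).real {i}| := by
  set φ := firstNear (ε / 4) z with hφdef
  have hφ : Measurable φ := (measurable_firstNear (ε / 4)).comp measurable_prodMk_left
  have := Measure.isProbabilityMeasure_map (μ := p) hφ.aemeasurable
  have := Measure.isProbabilityMeasure_map (μ := q) hφ.aemeasurable
  by_contra! hlt
  refine absurd hfar (not_lt.2 ?_)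
  have hbound := EMD_le_of_partition p q hφ hp hq (M := ENNReal.ofReal (D * ε))
    (R := fun i => if i = Fin.last n then ENNReal.ofReal (D * ε) else ENNReal.ofReal (ε / 2))
    (fun x hx y hy => by
      rw [edist_dist]; exact ENNReal.ofReal_le_ofReal (hQ x hx y hy))
    (fun x hx y hy hxy => by
      rw [edist_dist]
      split_ifs with h
      · exact ENNReal.ofReal_le_ofReal (hQ x hx y hy)
      · refine ENNReal.ofReal_le_ofReal ?_
        have := dist_le_of_firstNear_eq_firstNear hxy h
        linarith)
  refine hbound.trans ?_
  have h1 : ∑ i, (if i = Fin.last n then ENNReal.ofReal (D * ε) else ENNReal.ofReal (ε / 2)) *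
      min (p (φ ⁻¹' {i})) (q (φ ⁻¹' {i})) ≤
      ENNReal.ofReal (D * ε) * ENNReal.ofReal (1 / (4 * D)) + ENNReal.ofReal (ε / 2) := by
    -- Mass matched inside the uncovered cell is at most its `p`-mass, so covering `p` alone is
    -- enough.
    have hlast : p (φ ⁻¹' {Fin.last n}) ≤ ENNReal.ofReal (1 / (4 * D)) :=
      (ENNReal.le_ofReal_iff_toReal_le (measure_ne_top _ _) (by positivity)).2 hz
    calc _ ≤ ∑ i, ((if i = Fin.last n then ENNReal.ofReal (D * ε) * p (φ ⁻¹' {i}) else 0) +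
          ENNReal.ofReal (ε / 2) * p (Set.univ ∩ φ ⁻¹' {i})) := by
          refine Finset.sum_le_sum fun i _ => ?_
          rw [Set.univ_inter]
          split_ifs with h
          · exact le_add_right (by gcongr; exact min_le_left _ _)
          · rw [zero_add]; gcongr; exact min_le_left _ _
      _ = ENNReal.ofReal (D * ε) * p (φ ⁻¹' {Fin.last n}) + ENNReal.ofReal (ε / 2) := by
          rw [Finset.sum_add_distrib, ← Finset.mul_sum,
            sum_measure_inter_fiber p hφ MeasurableSet.univ]
          simp
      _ ≤ _ := by gcongr
  have h2 : ∑ i, (p (φ ⁻¹' {i}) - q (φ ⁻¹' {i})) ≤ ENNReal.ofReal (1 / (4 * D)) := by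
    have h := sum_measure_sub_eq (p.map φ) (q.map φ)
    simp only [Measure.map_apply hφ (measurableSet_singleton _)] at h
    rw [h]
    refine ENNReal.ofReal_le_ofReal ?_
    have : 1 / (4 * D) = 1 / (2 * D) / 2 := by field_simp; norm_num
    rw [this]
    linarith
  calc _ ≤ ENNReal.ofReal (D * ε) * ENNReal.ofReal (1 / (4 * D)) + ENNReal.ofReal (ε / 2) +
        ENNReal.ofReal (D * ε) * ENNReal.ofReal (1 / (4 * D)) := by gcongr
    -- The budget is `ε/4` for the uncovered cell, `ε/2` inside balls and `ε/4` for the unmatched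
    -- mass.
    _ = ENNReal.ofReal ε := by
        rw [← ENNReal.ofReal_mul (by positivity), ← ENNReal.ofReal_add (by positivity)
          (by positivity), ← ENNReal.ofReal_add (by positivity) (by positivity)]
        congr 1; field_simp; norm_num

open Classical in
/-- The answer of the tester on the given samples. -/
def coverAnswer (X : Type*) [PseudoMetricSpace X] (n : ℕ) (r D : ℝ)
    (s : (Fin (n + (n + (n + n))) → X) × (Fin (n + (n + (n + n))) → X)) : Bool :=
  if pairBlocks n s ∈ blockRejectSet X n r D then false else true

lemma measurable_pairBlocks {Z : Type*} [MeasurableSpace Z] (n : ℕ) :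
    Measurable (pairBlocks n : _ → (Fin n → Z × Z) × _) := by
  unfold pairBlocks splitBlocks
  fun_prop

lemma measurable_coverAnswer (n : ℕ) (r D : ℝ) : Measurable (coverAnswer X n r D) :=
  Measurable.ite (measurable_pairBlocks n (measurableSet_blockRejectSet n r D))
    measurable_const measurable_const

/-- The closeness tester that covers the space by balls of radius `r` around sample points and
tests closeness of the induced distributions on the cells. -/
def coverTester (X : Type*) [PseudoMetricSpace X] [MeasurableSpace X] [OpensMeasurableSpace X]
    [SecondCountableTopology X] (n : ℕ) (r D : ℝ) : SampleTester X where
  n := n + (n + (n + n))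
  rule := Kernel.deterministic (coverAnswer X n r D) (measurable_coverAnswer n r D)
  markov := inferInstance

lemma two_thirds_le_of_measureReal_compl_le {α : Type*} [MeasurableSpace α] (μ : Measure α)
    [IsProbabilityMeasure μ] {S : Set α} (hS : MeasurableSet S) (h : μ.real Sᶜ ≤ 1 / 3) :
    2 / 3 ≤ μ S := by
  rw [probReal_compl_eq_one_sub hS] at h
  have h' : (2 / 3 : ℝ) ≤ μ.real S := by linarith
  have := (ENNReal.ofReal_le_iff_le_toReal (measure_ne_top μ S)).2 h'
  rwa [ENNReal.ofReal_div_of_pos (by norm_num), ENNReal.ofReal_ofNat, ENNReal.ofReal_ofNat] at this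

lemma coverTester_answerLaw (p q : Measure X) [IsProbabilityMeasure p] [IsProbabilityMeasure q]
    (n : ℕ) (r D : ℝ) (b : Bool) :
    (coverTester X n r D).answerLaw p q {b} =
      ((Measure.pi fun _ : Fin n => p.prod q).prod ((Measure.pi fun _ : Fin n => p.prod q).prod
        ((Measure.pi fun _ : Fin n => p.prod q).prod (Measure.pi fun _ : Fin n => p.prod q))))
        (if b then (blockRejectSet X n r D)ᶜ else blockRejectSet X n r D) := by
  have h : (coverTester X n r D).answerLaw p q =
      ((Measure.pi fun _ => p).prod (Measure.pi fun _ => q)).map (coverAnswer X n r D) :=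
    Measure.deterministic_comp_eq_map (measurable_coverAnswer n r D)
  have hm := measurableSet_blockRejectSet (X := X) n r D
  rw [h, Measure.map_apply (measurable_coverAnswer n r D) (measurableSet_singleton b),
    ← (measurePreserving_pairBlocks p q n).measure_preimage
      (by cases b <;> simp [hm])]
  congr 1
  ext s
  cases b <;> simp [coverAnswer]

/-- The answers of the cover tester are correct with probability at least `2 / 3`. -/
theorem coverTester_isEMDClosenessTester {Q : Set X} {k n : ℕ} {ε D : ℝ} (hε : 0 < ε)
    (hD : 1 ≤ D) (hQ : ∀ x ∈ Q, ∀ y ∈ Q, dist x y ≤ D * ε) (hnk : 36 * (k * D) ≤ n)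
    (hn : 10 ^ 12 * D ^ 4 ≤ n) :
    (coverTester X n (ε / 4) D).IsEMDClosenessTester ε
      {pq | IsProbabilityMeasure pq.1 ∧ IsProbabilityMeasure pq.2 ∧ pq.1 Qᶜ = 0 ∧ pq.2 Qᶜ = 0 ∧
        Clusterable (pq.1.support ∪ pq.2.support) k (ε / 4)} := by
  rintro p q ⟨hp, hq, hpQ, hqQ, K, hK, -, hdiam⟩
  dsimp only at hp hq hpQ hqQ hK
  have hn' : (0 : ℝ) < n := lt_of_lt_of_le (by positivity) hn
  have hn0 : 0 < n := by exact_mod_cast hn'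
  have hm := measurableSet_blockRejectSet (X := X) n (ε / 4) D
  have hprob (z : Fin n → X) (μ : Measure X) [IsProbabilityMeasure μ] :
      IsProbabilityMeasure (μ.map (firstNear (ε / 4) z)) :=
    Measure.isProbabilityMeasure_map
      ((measurable_firstNear (ε / 4)).comp measurable_prodMk_left).aemeasurable
  constructor
  · rintro rfl
    rw [coverTester_answerLaw, if_pos rfl]
    refine two_thirds_le_of_measureReal_compl_le _ hm.compl ?_
    rw [compl_compl]
    -- For `p = q` the cell distributions agree whatever the cover is, so no cover is bad.
    refine (measureReal_prod_le_add (G := Set.univ) (a := 0) (b := 2 / 9) _ _ hm (by norm_num)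
      (by simp) fun ω _ => ?_).trans (by norm_num)
    have := hprob (coverPoints ω) p
    exact (measureReal_section_blockRejectSet p p n (ε / 4) _ (coverPoints ω)).trans_le
      (measureReal_rejectSet_le _ n D (by linarith) hn)
  · intro hfar
    rw [coverTester_answerLaw, if_neg (by simp)]
    refine two_thirds_le_of_measureReal_compl_le _ hm ?_
    have hcov := measureReal_uncovered_le p (K := K) (by
      rw [hK]
      exact measure_mono_null (Set.compl_subset_compl.2 Set.subset_union_left)
        Measure.measure_compl_support) hdiam hn0 (η := 1 / (4 * D)) (by positivity)
    refine (measureReal_prod_le_add (a := 1 / 9) (b := 2 / 9) _ _ hm.compl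
      (G := coverPoints ⁻¹' {z | 1 / (4 * D) ≤ p.real (firstNear (ε / 4) z ⁻¹' {Fin.last n})}ᶜ)
      (by norm_num) ?_ fun ω hω => ?_).trans (by norm_num)
    · rw [← Set.preimage_compl, compl_compl]
      have hS : MeasurableSet {z : Fin n → X | 1 / (4 * D) ≤
          p.real (firstNear (ε / 4) z ⁻¹' {Fin.last n})} :=
        measurableSet_le measurable_const (measurable_measure_prodMk_left
          (measurable_firstNear (ε / 4) (measurableSet_singleton (Fin.last n)))).ennreal_toReal
      rw [(measurePreserving_coverPoints p q n).measureReal_preimage hS.nullMeasurableSet]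
      refine hcov.trans ?_
      -- Markov's bound `4kD/n` is at most `1/9` exactly when `36kD ≤ n`.
      rw [div_div_eq_mul_div, div_one, div_mul_eq_mul_div, div_le_div_iff₀ hn' (by norm_num)]
      linarith
    · have := hprob (coverPoints ω) p
      have := hprob (coverPoints ω) q
      have hω' : p.real (firstNear (ε / 4) (coverPoints ω) ⁻¹' {Fin.last n}) < 1 / (4 * D) :=
        not_le.1 hω
      exact (measureReal_section_blockRejectSet p q n (ε / 4) _ (coverPoints ω)).trans_le
        (measureReal_rejectSet_compl_le _ _ n D hD hn (by simp)
          (le_sum_abs_of_lt_EMD p q hpQ hqQ hε (by linarith) hQ hfar _ hω'.le))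

end Tester

/-! ### The cube, the degenerate cases and the sample count -/

section Cube

lemma dist_le_of_mem_cube {d : ℕ} {Δ : ℝ} {x y : L1Space d} (hx : x ∈ cube d Δ)
    (hy : y ∈ cube d Δ) : dist x y ≤ d * Δ := by
  rw [PiLp.dist_eq_of_L1]
  calc ∑ i, dist (x i) (y i) ≤ ∑ _i : Fin d, Δ := by
        refine Finset.sum_le_sum fun i _ => ?_
        rw [Real.dist_eq, abs_le]
        constructor <;> linarith [(hx i).1, (hx i).2, (hy i).1, (hy i).2]
    _ = d * Δ := by simp

lemma EMD_le_of_cube {d : ℕ} {Δ : ℝ} (p q : Measure (L1Space d)) [IsProbabilityMeasure p]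
    [IsProbabilityMeasure q] (hp : p (cube d Δ)ᶜ = 0) (hq : q (cube d Δ)ᶜ = 0) :
    EMD p q ≤ ENNReal.ofReal (d * Δ) := by
  refine (iInf_le _ ⟨p.prod q, Measure.fst_prod, Measure.snd_prod⟩).trans ?_
  refine (lintegral_edist_prod_le p q hp hq (M := ENNReal.ofReal (d * Δ)) fun x hx y hy => ?_).trans
    (by simp)
  rw [edist_dist]
  exact ENNReal.ofReal_le_ofReal (dist_le_of_mem_cube hx hy)

/-- The tester that draws no samples and accepts. -/
def acceptTester (X : Type*) [MeasurableSpace X] : SampleTester X where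
  n := 0
  rule := Kernel.const _ (Measure.dirac true)
  markov := inferInstance

/-- No pair has to be rejected: for `k = 0` the support of a probability measure would be empty, and
otherwise the diameter of the cube bounds the EMD by `ε`. -/
lemma acceptTester_isEMDClosenessTester {d k : ℕ} {Δ ε b : ℝ}
    (h : k = 0 ∨ d * Δ ≤ ε) :
    (acceptTester (L1Space d)).IsEMDClosenessTester ε (clusterablePairs d Δ k b) := by
  rintro p q ⟨hp, hq, hpQ, hqQ, K, hK, -, -⟩
  dsimp only at hp hq hpQ hqQ hK
  constructor
  · rintro -
    have : (acceptTester (L1Space d)).answerLaw p q {true} = 1 := by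
      rw [SampleTester.answerLaw,
        Measure.bind_apply (measurableSet_singleton _) (Kernel.aemeasurable _)]
      change ∫⁻ _, Measure.dirac true {true} ∂((Measure.pi fun _ : Fin 0 => p).prod
        (Measure.pi fun _ : Fin 0 => q)) = 1
      simp
    rw [this]
    exact ENNReal.div_le_of_le_mul (by norm_num)
  · intro hfar
    rcases h with rfl | h
    · have hne : (p.support ∪ q.support).Nonempty :=
        (Measure.nonempty_support (IsProbabilityMeasure.ne_zero p)).mono Set.subset_union_left
      rw [← hK] at hne
      simp at hne
    · exact absurd hfar (not_lt.2 ((EMD_le_of_cube p q hpQ hqQ).trans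
        (ENNReal.ofReal_le_ofReal h)))

end Cube

lemma samples_bound_le {k : ℕ} {D : ℝ} (hD : 1 ≤ D) :
    k * D + (k : ℝ) ^ (2 / 3 : ℝ) * D ^ 4 ≤ 2 * (k * D ^ 4) := by
  have hk : (k : ℝ) ^ (2 / 3 : ℝ) ≤ k := by
    rcases Nat.eq_zero_or_pos k with rfl | hk
    · simp
    · exact (Real.rpow_le_rpow_of_exponent_le (by exact_mod_cast hk)
        (by norm_num : (2 / 3 : ℝ) ≤ 1)).trans_eq (Real.rpow_one _)
  have hD4 : D ≤ D ^ 4 := le_self_pow₀ hD (by norm_num)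
  have h1 : k * D ≤ k * D ^ 4 := by gcongr
  have h2 : (k : ℝ) ^ (2 / 3 : ℝ) * D ^ 4 ≤ k * D ^ 4 := by gcongr
  linarith

end EMDTesting

end

theorem theorem19 :
    ∃ (C : ℝ) (c : ℕ) (C' : ℝ) (c' : ℕ),
      ∀ (d : ℕ) (Δ ε : ℝ) (k : ℕ), 0 < Δ → 0 < ε →
        (∃ T : EMDTesting.SampleTester (EMDTesting.L1Space d),
          T.IsEMDClosenessTester ε (EMDTesting.clusterablePairs d Δ k (ε / 4)) ∧
          (T.samples : ℝ) ≤ EMDTesting.softBound C c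
            (k * (d * Δ / ε) + (k : ℝ) ^ (2 / 3 : ℝ) * (d * Δ / ε) ^ 4) ∧
          (T.samples : ℝ) ≤ EMDTesting.softBound C' c' (k * (d * Δ / ε) ^ 4)) ∧
        (ε ≤ d * Δ →
          EMDTesting.softBound C c
              (k * (d * Δ / ε) + (k : ℝ) ^ (2 / 3 : ℝ) * (d * Δ / ε) ^ 4) ≤
            EMDTesting.softBound C' c' (k * (d * Δ / ε) ^ 4)) := by
  -- Both log exponents are 0. The tester uses `8n` samples, whose main term is `8·10¹²D⁴`; the
  -- extra factor 2 comes from `samples_bound_le`.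
  refine ⟨10 ^ 13, 0, 2 * 10 ^ 13, 0, fun d Δ ε k hΔ hε => ?_⟩
  simp only [EMDTesting.softBound, pow_zero, mul_one]
  have hcomp : ε ≤ d * Δ →
      (10 : ℝ) ^ 13 * (k * (d * Δ / ε) + (k : ℝ) ^ (2 / 3 : ℝ) * (d * Δ / ε) ^ 4) ≤
        2 * 10 ^ 13 * (k * (d * Δ / ε) ^ 4) := fun h => by
    have := EMDTesting.samples_bound_le (k := k) ((one_le_div hε).2 h)
    linarith
  refine ⟨?_, hcomp⟩
  by_cases htriv : k = 0 ∨ d * Δ ≤ ε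
  · refine ⟨EMDTesting.acceptTester _, EMDTesting.acceptTester_isEMDClosenessTester htriv, ?_, ?_⟩
    all_goals
      simp only [EMDTesting.SampleTester.samples, EMDTesting.acceptTester, mul_zero, Nat.cast_zero]
      positivity
  · push Not at htriv
    obtain ⟨hk, hlt⟩ := htriv
    set D : ℝ := d * Δ / ε with hDdef
    have hD : 1 ≤ D := (one_le_div hε).2 hlt.le
    have hk1 : (1 : ℝ) ≤ k := by exact_mod_cast Nat.one_le_iff_ne_zero.2 hk
    set n := ⌈36 * (k * D) + 10 ^ 12 * D ^ 4⌉₊ with hndef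
    have hnle : 36 * (k * D) + 10 ^ 12 * D ^ 4 ≤ n := Nat.le_ceil _
    have hnlt : (n : ℝ) < 36 * (k * D) + 10 ^ 12 * D ^ 4 + 1 := Nat.ceil_lt_add_one (by positivity)
    have hkD : 1 ≤ k * D := one_le_mul_of_one_le_of_one_le hk1 hD
    have hD4 : 0 ≤ D ^ 4 := by positivity
    have hsamples : ((EMDTesting.coverTester (EMDTesting.L1Space d) n (ε / 4) D).samples : ℝ) ≤
        10 ^ 13 * (k * D + (k : ℝ) ^ (2 / 3 : ℝ) * D ^ 4) := by
      -- The tester pays only `D⁴` here; as `k ≥ 1`, this fits under the allowed term. The rounding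
      -- error of the ceiling is absorbed by `kD ≥ 1`.
      have hk23 : D ^ 4 ≤ (k : ℝ) ^ (2 / 3 : ℝ) * D ^ 4 :=
        le_mul_of_one_le_left hD4 (Real.one_le_rpow hk1 (by norm_num))
      simp only [EMDTesting.SampleTester.samples, EMDTesting.coverTester]
      push_cast
      linarith
    refine ⟨EMDTesting.coverTester _ n (ε / 4) D, ?_, hsamples, hsamples.trans (hcomp hlt.le)⟩
    refine EMDTesting.coverTester_isEMDClosenessTester hε hD (fun x hx y hy => ?_)
      (by linarith) (by linarith)
    rw [hDdef, div_mul_cancel₀ _ hε.ne']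
    exact EMDTesting.dist_le_of_mem_cube hx hy
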